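/- Let $q\in\mathbb C$ with $0<|q|<1$, fractional powers of $q$ being principal values (so the positive ones if $0<q<1$). Put $(a;q)_n=\prod_{k=0}^{n-1}(1-aq^k)$ and $(a;q)_\infty=\prod_{k=0}^{\infty}(1-aq^k)$. For $x=\cos\theta$, $\theta\in\mathbb C$, let $$\mathcal E_q(x;a,b)=\sum_{n=0}^\infty \frac{q^{n^2/4}}{(q;q)_n}\,\bigl(aq^{(1-n)/2}e^{i\theta};q\bigr)_n\bigl(aq^{(1-n)/2}e^{-i\theta};q\bigr)_n\,b^n$$ be the Ismail–Zhang $q$-exponential; for $a=0$ it does not depend on $x$ and is written $\mathcal E_q(-;0,b)=\sum_{k\ge0}\frac{q^{k^2/4}}{(q;q)_k}b^k$. Let $$H_n(x;a|q)=e^{in\theta}\,{}_2\phi_0\!\left({q^{-n},\,ae^{i\theta}\atop -}\Big|\,q;\,q^ne^{-2i\theta}\right)=e^{in\theta}\sum_{k=0}^{n}\frac{(q^{-n};q)_k\,(ae^{i\theta};q)_k}{(q;q)_k}\,\bigl[(-1)^kq^{k(k-1)/2}\bigr]^{-1}\bigl(q^ne^{-2i\theta}\bigr)^k$$ be the continuous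 big $q$-Hermite polynomials. Then for every integer $m$, every $b\in\mathbb C$ with $|b|<2$ and every $x=\cos\theta$, $\theta\in\mathbb C$, one has $(-b^2/4;q^2)_\infty\neq0$ and $$\mathcal E_q(x;-i,b/2)=\frac{1}{(-b^2/4;q^2)_\infty}\sum_{n=0}^\infty\frac{q^{n^2/4}}{(q;q)_n}\,\mathcal E_q\!\left(-;0,\tfrac{ib}{2}q^{(m+n)/2}\right)\left(\tfrac{ib}{2}\right)^n H_n\bigl(x;q^{m/2}\,|\,q\bigr),$$ where the series on the right, the series defining $\mathcal E_q(x;-i,b/2)$ and the series defining the values $\mathcal E_q(-;0,\cdot)$ all converge absolutely. -/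

import Mathlib

/-- The finite `q`-shifted factorial `(a; q)_n = ∏_{k=0}^{n-1} (1 - a q^k)`. -/
noncomputable def qPoch (a q : ℂ) (n : ℕ) : ℂ :=
  ∏ k ∈ Finset.range n, (1 - a * q ^ k)

/-- The infinite `q`-shifted factorial `(a; q)_∞ = ∏_{k ≥ 0} (1 - a q^k)`, for `|q| < 1`. -/
noncomputable def qPochInf (a q : ℂ) : ℂ :=
  ∏' k : ℕ, (1 - a * q ^ k)

/-- The product defining `(a; q)_∞` converges for every `a` when `|q| < 1`. -/
theorem multipliable_qPochInf (a q : ℂ) (hq : ‖q‖ < 1) :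
    Multipliable (fun k : ℕ => 1 - a * q ^ k) := by
  have h : Summable (fun k : ℕ => ‖-(a * q ^ k)‖) := by
    simp only [norm_neg, norm_mul, norm_pow]
    exact (summable_geometric_of_lt_one (norm_nonneg q) hq).mul_left ‖a‖
  simpa [sub_eq_add_neg] using multipliable_one_add_of_summable h

/-- The basic hypergeometric series `_rφ_s(as; bs | q; z)`, where `r` and `s` are the lengths
of the lists `as` and `bs`. -/
noncomputable def basicHypergeometric (as bs : List ℂ) (q z : ℂ) : ℂ :=
  ∑' n : ℕ, (as.map (fun a => qPoch a q n)).prod / ((q :: bs).map (fun b => qPoch b q n)).prod *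
    ((-1) ^ n * q ^ (n * (n - 1) / 2)) ^ (1 + (bs.length : ℤ) - (as.length : ℤ)) * z ^ n

/-- The continuous big `q`-Hermite polynomial `H_n(x; a | q)` at `x = cos θ`:
`H_n(cos θ; a | q) = e^{inθ} _2φ_0(q^{-n}, a e^{iθ}; - | q; q^n e^{-2iθ})`. -/
noncomputable def bigQHermite (q : ℂ) (n : ℕ) (θ a : ℂ) : ℂ :=
  Complex.exp (Complex.I * n * θ) *
    basicHypergeometric [q ^ (-(n : ℤ)), a * Complex.exp (Complex.I * θ)] [] q
      (q ^ n * Complex.exp (-2 * Complex.I * θ))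

/-- The `n`-th term of the series defining the `q`-exponential `𝓔_q(x; a, b)` at `x = cos θ`.
Fractional powers of `q` are principal values; for `0 < q < 1` they are the positive ones. -/
noncomputable def qExpTerm (q θ a b : ℂ) (n : ℕ) : ℂ :=
  q ^ ((n : ℂ) ^ 2 / 4) / qPoch q q n *
    qPoch (a * q ^ ((1 - (n : ℂ)) / 2) * Complex.exp (Complex.I * θ)) q n *
    qPoch (a * q ^ ((1 - (n : ℂ)) / 2) * Complex.exp (-Complex.I * θ)) q n * b ^ n

/-- The Ismail–Zhang `q`-exponential `𝓔_q(x; a, b)` at `x = cos θ`. -/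
noncomputable def qExp (q θ a b : ℂ) : ℂ :=
  ∑' n : ℕ, qExpTerm q θ a b n

/-!
Write `t = ib/2`, `z = e^{iθ}`, `a = q^{m/2}`, and let `H_n(x | q) = H_n(x; 0 | q)` be the continuous
`q`-Hermite polynomials. The expansion is the combination of two facts.

* The Ismail–Zhang expansion
  `(t²; q²)_∞ 𝓔_q(x; -i, -it) = ∑ q^{n²/4} H_n(x | q) tⁿ / (q; q)_n`. The series `F(t)` on the right
  satisfies a `q`-difference equation in the shifts `t`, `q^{1/2} t`, `q t`
  (`thetaHermiteSeries_rescale`). Eliminating the half shifts and dividing by `(t²; q²)_∞`, one finds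
  for the coefficients of `F(t) / (t²; q²)_∞` a recursion from `n` to `n + 2`
  (`coeff_theta_mul_evenEuler_succ_succ`). The coefficients of `𝓔_q` satisfy the same recursion
  (`qExpCoeff_succ_succ`), and the first two coefficients agree (`qExpCoeff_eq_coeff`).
* The connection relation `H_n(x | q) / (q; q)_n = ∑_{j+k=n} a^j / (q; q)_j · H_k(x; a | q) / (q; q)_k`,
  which holds for every `a`. It compares generating functions and comes from the `q`-binomial theorem
  (`eulerSeries_mul_bigQHermiteSeries`).

Inserting the second in the first gives a double series, which converges absolutely because of the
factor `q^{(j+k)²/4}`. Since `q^{(j+k)²/4} = q^{k²/4} q^{j²/4} q^{jk/2}`, its sum over `j` is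
`q^{k²/4} 𝓔_q(-; 0, t a q^{k/2})` times the remaining factors (`thetaHermite_eval`).

All `q`-difference equations are identities of formal power series in `t`, with `PowerSeries.rescale`
as the shift; convergence enters only when these series are evaluated.
-/

/-! ### Shifted factorials and generating functions -/

/-- The series `1 / (ut; q)_∞ = ∑ uⁿ tⁿ / (q; q)_n`, as a formal power series in `t`. -/
noncomputable def eulerSeries (q u : ℂ) : PowerSeries ℂ :=
  PowerSeries.mk fun n => u ^ n / qPoch q q n

/-- The `q`-binomial series `(ut; q)_∞ / (t; q)_∞ = ∑ (u; q)_n tⁿ / (q; q)_n`, as a formal power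
series in `t`. -/
noncomputable def qBinomialSeries (q u : ℂ) : PowerSeries ℂ :=
  PowerSeries.mk fun n => qPoch u q n / qPoch q q n

/-- The generating function `∑ H_n(x; a | q) tⁿ / (q; q)_n` of the continuous big `q`-Hermite
polynomials at `x = (z + z⁻¹) / 2`, as a product of two explicit formal power series in `t`. -/
noncomputable def bigQHermiteSeries (q a z : ℂ) : PowerSeries ℂ :=
  PowerSeries.rescale z⁻¹ (qBinomialSeries q (a * z)) * eulerSeries q z

lemma qPoch_zero (a q : ℂ) : qPoch a q 0 = 1 := by simp [qPoch]

lemma qPoch_succ (a q : ℂ) (n : ℕ) : qPoch a q (n + 1) = qPoch a q n * (1 - a * q ^ n) := by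
  simp [qPoch, Finset.prod_range_succ]

lemma qPoch_zero_left (q : ℂ) (n : ℕ) : qPoch 0 q n = 1 := by simp [qPoch]

lemma one_sub_pow_succ_ne_zero {q : ℂ} (hq : ‖q‖ < 1) (n : ℕ) : 1 - q ^ (n + 1) ≠ 0 := by
  intro h
  have h1 : ‖q ^ (n + 1)‖ = 1 := by rw [← sub_eq_zero.mp h, norm_one]
  rw [norm_pow] at h1
  exact (pow_lt_one₀ (norm_nonneg q) hq n.succ_ne_zero).ne h1

lemma qPoch_self_succ (q : ℂ) (n : ℕ) :
    qPoch q q (n + 1) = qPoch q q n * (1 - q ^ (n + 1)) := by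
  rw [qPoch_succ, pow_succ']

lemma qPoch_self_ne_zero {q : ℂ} (hq : ‖q‖ < 1) (n : ℕ) : qPoch q q n ≠ 0 := by
  induction n with
  | zero => simp [qPoch]
  | succ n ih =>
    rw [qPoch_self_succ]
    exact mul_ne_zero ih (one_sub_pow_succ_ne_zero hq n)

/-! ### The `q`-difference equations of the formal power series -/

section Formal

open PowerSeries

lemma rescale_C_eq (a c : ℂ) : rescale a (C c) = C c := by
  ext n
  rcases n with _ | n <;> simp [coeff_rescale, coeff_C]

lemma eulerSeries_eq_rescale (q u : ℂ) : eulerSeries q u = rescale u (eulerSeries q 1) := by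
  ext n
  simp [eulerSeries, div_eq_mul_inv]

lemma rescale_eulerSeries {q : ℂ} (hq : ‖q‖ < 1) (u : ℂ) :
    rescale q (eulerSeries q u) = (1 - C u * X) * eulerSeries q u := by
  ext n
  rw [sub_mul, one_mul, mul_assoc]
  rcases n with _ | n
  · simp [eulerSeries]
  · have h1 := qPoch_self_ne_zero hq n
    have h2 := one_sub_pow_succ_ne_zero hq n
    simp only [map_sub, coeff_C_mul, coeff_succ_X_mul, coeff_rescale, eulerSeries, coeff_mk,
      qPoch_self_succ]
    field_simp
    ring

/-- The `q`-difference equation `(1 - t) f(t) = (1 - ut) f(qt)` of the `q`-binomial series. -/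
lemma qBinomialSeries_rescale {q : ℂ} (hq : ‖q‖ < 1) (u : ℂ) :
    (1 - X) * qBinomialSeries q u = (1 - C u * X) * rescale q (qBinomialSeries q u) := by
  ext n
  rw [sub_mul, one_mul, sub_mul, one_mul, mul_assoc]
  rcases n with _ | n
  · simp [-coeff_zero_eq_constantCoeff, coeff_rescale, coeff_zero_X_mul]
  · have h1 := qPoch_self_ne_zero hq n
    have h2 := one_sub_pow_succ_ne_zero hq n
    simp only [map_sub, coeff_C_mul, coeff_succ_X_mul, coeff_rescale, qBinomialSeries, coeff_mk,
      qPoch_self_succ, qPoch_succ u q]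
    field_simp
    ring

/-- A formal solution of `f(qt) = (1 - t) f(t)` is determined by its constant term. -/
lemma eq_of_rescale_eq {q : ℂ} (hq : ‖q‖ < 1) {f g : PowerSeries ℂ}
    (hf : rescale q f = (1 - X) * f) (hg : rescale q g = (1 - X) * g)
    (h0 : coeff 0 f = coeff 0 g) : f = g := by
  ext n
  induction n with
  | zero => exact h0
  | succ n ih =>
    have h1 := congrArg (coeff (n + 1)) hf
    have h2 := congrArg (coeff (n + 1)) hg
    simp only [sub_mul, one_mul, map_sub, coeff_succ_X_mul, coeff_rescale] at h1 h2
    refine mul_left_cancel₀ (one_sub_pow_succ_ne_zero hq n) ?_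
    linear_combination h2 - h1 + ih

/-- The `q`-binomial theorem `(ut; q)_∞ / (t; q)_∞ = ∑ (u; q)_n tⁿ / (q; q)_n`, with
the denominators cleared. -/
lemma eulerSeries_mul_qBinomialSeries {q : ℂ} (hq : ‖q‖ < 1) (u : ℂ) :
    eulerSeries q u * qBinomialSeries q u = eulerSeries q 1 := by
  refine eq_of_rescale_eq hq ?_ ?_ ?_
  · rw [map_mul, rescale_eulerSeries hq]
    linear_combination (-eulerSeries q u) * qBinomialSeries_rescale hq u
  · simpa using rescale_eulerSeries hq 1
  · simp [eulerSeries, qBinomialSeries, qPoch_zero]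

lemma bigQHermiteSeries_zero (q z : ℂ) :
    bigQHermiteSeries q 0 z = eulerSeries q z⁻¹ * eulerSeries q z := by
  rw [bigQHermiteSeries, eulerSeries_eq_rescale q z⁻¹]
  congr 2
  simp [qBinomialSeries, eulerSeries, qPoch_zero_left]

/-- The connection relation between the polynomials `H_n(x; a | q)` and `H_n(x; 0 | q)`. -/
lemma eulerSeries_mul_bigQHermiteSeries {q z : ℂ} (hq : ‖q‖ < 1) (hz : z ≠ 0) (a : ℂ) :
    eulerSeries q a * bigQHermiteSeries q a z = bigQHermiteSeries q 0 z := by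
  have h : eulerSeries q a = rescale z⁻¹ (eulerSeries q (a * z)) := by
    rw [eulerSeries_eq_rescale q a, eulerSeries_eq_rescale q (a * z), rescale_rescale]
    congr 2
    field_simp
  rw [bigQHermiteSeries_zero, bigQHermiteSeries, ← mul_assoc, h, ← map_mul,
    eulerSeries_mul_qBinomialSeries hq, ← eulerSeries_eq_rescale]

lemma rescale_bigQHermiteSeries_zero {q z : ℂ} (hq : ‖q‖ < 1) (hz : z ≠ 0) :
    rescale q (bigQHermiteSeries q 0 z) =
      (1 - C (z + z⁻¹) * X + X * X) * bigQHermiteSeries q 0 z := by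
  have h : (C z⁻¹ * C z : PowerSeries ℂ) = 1 := by rw [← map_mul, inv_mul_cancel₀ hz, map_one]
  rw [bigQHermiteSeries_zero, map_mul, rescale_eulerSeries hq, rescale_eulerSeries hq, map_add]
  linear_combination (X * X * eulerSeries q z⁻¹ * eulerSeries q z) * h

/-- The formal power series `∑ r^{n²} H_n(x; 0 | q) tⁿ / (q; q)_n`, where `r` stands for
`q^{1/4}`. -/
noncomputable def thetaHermiteSeries (q r z : ℂ) : PowerSeries ℂ :=
  PowerSeries.mk fun n => r ^ (n ^ 2) * coeff n (bigQHermiteSeries q 0 z)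

/-- The three-term recurrence of the polynomials `H_n(x; 0 | q)` turns into a `q`-difference
equation with the half shift `t ↦ q^{1/2} t`, because the weights `r^{n²}` have ratios
`r^{2n+1} = r (r²)ⁿ`. -/
lemma thetaHermiteSeries_rescale {q r z : ℂ} (hq : ‖q‖ < 1) (hz : z ≠ 0) (hr : r ^ 4 = q) :
    thetaHermiteSeries q r z =
      C (r * (z + z⁻¹)) * X * rescale (r ^ 2) (thetaHermiteSeries q r z) +
        (1 - C q * X * X) * rescale q (thetaHermiteSeries q r z) := by
  have key := rescale_bigQHermiteSeries_zero hq hz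
  generalize z + z⁻¹ = w at key ⊢
  rw [add_mul, sub_mul, one_mul, mul_assoc, mul_assoc] at key
  rw [sub_mul, one_mul]
  ext n
  have kn := congrArg (coeff n) key
  rcases n with _ | _ | n
  · simp [mul_assoc, -coeff_zero_eq_constantCoeff, coeff_rescale, coeff_zero_X_mul]
  · simp only [mul_assoc, map_add, map_sub, coeff_C_mul, coeff_succ_X_mul, coeff_rescale,
      coeff_zero_X_mul, thetaHermiteSeries, coeff_mk] at kn ⊢
    simp only [zero_add, mul_zero, pow_one, pow_zero, one_mul] at kn ⊢
    linear_combination (-r) * kn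
  · simp only [mul_assoc, map_add, map_sub, coeff_C_mul, coeff_succ_X_mul, coeff_rescale,
      thetaHermiteSeries, coeff_mk] at kn ⊢
    subst hr
    linear_combination (-r ^ ((n + 2) ^ 2)) * kn

/-- The series `1 / (t²; q²)_∞ = ∑ t^{2s} / (q²; q²)_s`, as a formal power series in `t`. -/
noncomputable def evenEulerSeries (q : ℂ) : PowerSeries ℂ :=
  PowerSeries.mk fun n => if Even n then (qPoch (q ^ 2) (q ^ 2) (n / 2))⁻¹ else 0

lemma norm_sq_lt_one {q : ℂ} (hq : ‖q‖ < 1) : ‖q ^ 2‖ < 1 := by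
  rw [norm_pow]
  exact pow_lt_one₀ (norm_nonneg q) hq two_ne_zero

lemma rescale_evenEulerSeries {q : ℂ} (hq : ‖q‖ < 1) :
    rescale q (evenEulerSeries q) = (1 - X * X) * evenEulerSeries q := by
  ext n
  rw [sub_mul, one_mul, mul_assoc]
  rcases n with _ | _ | n
  · simp
  · simp [evenEulerSeries]
  · simp only [map_sub, coeff_succ_X_mul, coeff_rescale, evenEulerSeries, coeff_mk]
    by_cases h : Even n
    · obtain ⟨s, rfl⟩ := h
      have h1 := qPoch_self_ne_zero (norm_sq_lt_one hq) s
      have h2 := one_sub_pow_succ_ne_zero (norm_sq_lt_one hq) s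
      have e1 : (s + s + 1 + 1) / 2 = s + 1 := by omega
      have e2 : (s + s) / 2 = s := by omega
      have e3 : Even (s + s + 1 + 1) := ⟨s + 1, by ring⟩
      have e4 : Even (s + s) := ⟨s, rfl⟩
      rw [if_pos e3, if_pos e4, e1, e2, qPoch_self_succ]
      field_simp
      ring
    · have h' : ¬ Even (n + 1 + 1) := by
        rwa [Nat.even_add_one, Nat.even_add_one, not_not]
      simp [h, h']

/-- The second-order recursion satisfied by the coefficients of
`(t²; q²)_∞⁻¹ ∑ q^{n²/4} H_n(x; 0 | q) tⁿ / (q; q)_n`. -/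
lemma coeff_theta_mul_evenEuler_succ_succ {q r z : ℂ} (hq : ‖q‖ < 1) (hz : z ≠ 0)
    (hr : r ^ 4 = q) (n : ℕ) :
    (q - q ^ (n + 2)) * (1 - q ^ (n + 2)) *
        coeff (n + 2) (thetaHermiteSeries q r z * evenEulerSeries q) =
      (q + q ^ 2 * (z ^ 2 + z⁻¹ ^ 2) * q ^ n + q ^ 3 * q ^ (2 * n)) *
        coeff n (thetaHermiteSeries q r z * evenEulerSeries q) := by
  set F := thetaHermiteSeries q r z with hF
  set Q := evenEulerSeries q with hQ
  have f0 : F = C (r * (z + z⁻¹)) * X * rescale (r ^ 2) F + (1 - C q * X * X) * rescale q F :=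
    thetaHermiteSeries_rescale hq hz hr
  have f1 := congrArg (rescale (r ^ 2)) f0
  have f2 := congrArg (rescale q) f0
  have g0 : rescale q Q = (1 - X * X) * Q := rescale_evenEulerSeries hq
  have g1 := congrArg (rescale q) g0
  have e1 : r ^ 2 * r ^ 2 = q := by rw [← hr]; ring
  have e2 : q * r ^ 2 = r ^ 2 * q := mul_comm _ _
  simp only [map_add, map_mul, map_sub, map_one, rescale_C_eq, rescale_X, rescale_rescale, e1, e2]
    at f0 f1 f2 g1
  have hzz : (C z * C z⁻¹ : PowerSeries ℂ) = 1 := by rw [← map_mul, mul_inv_cancel₀ hz, map_one]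
  have hrq : (C r : PowerSeries ℂ) ^ 4 = C q := by rw [← map_pow, hr]
  have hrq2 : (C (r ^ 2) : PowerSeries ℂ) = C r ^ 2 := map_pow _ _ _
  have key : C q * (1 - X * X) * (F * Q) =
      (C q + 1 + C q ^ 2 * (C z ^ 2 + C z⁻¹ ^ 2) * X * X) * rescale q (F * Q) -
        (1 - C q ^ 3 * X * X) * rescale (q * q) (F * Q) := by
    rw [map_mul, map_mul]
    -- The shifts of `f0` by `r²` and `q` eliminate the half shifts `t ↦ r² t` and `t ↦ r² q t`.
    have hFF : C q * F = (C q + 1 + C q ^ 2 * (C z ^ 2 + C z⁻¹ ^ 2) * X * X) * rescale q F -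
        (1 - C q ^ 2 * X * X) * (1 - C q ^ 3 * X * X) * rescale (q * q) F := by
      simp only [hrq2, ← hrq] at f0 f1 f2 ⊢
      linear_combination C r ^ 4 * f0 + C r ^ 5 * (C z + C z⁻¹) * X * f1 -
        (1 - C r ^ 8 * X * X) * f2 + 2 * C r ^ 8 * X * X * rescale q F * hzz
    linear_combination rescale q Q * hFF - C q * F * g0 +
      (1 - C q ^ 3 * X * X) * rescale (q * q) F * g1
  generalize F * Q = G at key ⊢
  have key' : C q * G - C q * (X * (X * G)) =
      C (q + 1) * rescale q G + C (q ^ 2 * (z ^ 2 + z⁻¹ ^ 2)) * (X * (X * rescale q G)) -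
        (rescale (q * q) G - C (q ^ 3) * (X * (X * rescale (q * q) G))) := by
    simp only [map_add, map_mul, map_pow, map_one] at key ⊢
    linear_combination key
  have kn := congrArg (coeff (n + 1 + 1)) key'
  simp only [map_add (coeff _), map_sub, coeff_C_mul, coeff_succ_X_mul, coeff_rescale] at kn
  linear_combination kn

end Formal

/-! ### The coefficients of the `q`-exponential -/

/-- The coefficient of `tⁿ` in `𝓔_q(x; -i, -it)`, where `x = (z + z⁻¹) / 2` and `r` stands for
`q^{1/4}`. -/
noncomputable def qExpCoeff (q r z : ℂ) (n : ℕ) : ℂ :=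
  r ^ (n ^ 2) / qPoch q q n *
    qPoch (-Complex.I * (r ^ 2) ^ (1 - (n : ℤ)) * z) q n *
    qPoch (-Complex.I * (r ^ 2) ^ (1 - (n : ℤ)) * z⁻¹) q n * (-Complex.I) ^ n

lemma qPoch_mul_inv_add_two {q : ℂ} (hq0 : q ≠ 0) (a : ℂ) (n : ℕ) :
    qPoch (a * q⁻¹) q (n + 2) = (1 - a * q⁻¹) * (1 - a * q ^ n) * qPoch a q n := by
  have h : ∀ k : ℕ, a * q⁻¹ * q ^ (k + 1) = a * q ^ k := fun k => by
    rw [pow_succ']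
    field_simp
  simp only [qPoch, Finset.prod_range_succ' _ (n + 1), h, Finset.prod_range_succ _ n]
  ring

/-- Passing from `n` to `n + 2` adds one factor at each end of both shifted factorials, so the
coefficients of even and of odd index each satisfy a first-order recursion. -/
lemma qExpCoeff_succ_succ {q r z : ℂ} (hq0 : q ≠ 0) (hq : ‖q‖ < 1) (hz : z ≠ 0)
    (hr : r ^ 4 = q) (n : ℕ) :
    (q - q ^ (n + 2)) * (1 - q ^ (n + 2)) * qExpCoeff q r z (n + 2) =
      (q + q ^ 2 * (z ^ 2 + z⁻¹ ^ 2) * q ^ n + q ^ 3 * q ^ (2 * n)) * qExpCoeff q r z n := by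
  have hr0 : r ≠ 0 := by
    rintro rfl
    exact hq0 (by rw [← hr]; norm_num)
  have hp : (r ^ 2) ^ 2 = q := by rw [← hr]; ring
  set p := r ^ 2 with hpdef
  have hp0 : p ≠ 0 := pow_ne_zero 2 hr0
  -- Both end factors are expressed through `P = q^{(n+1)/2}`.
  set P := p ^ (n + 1) with hP
  have hP0 : P ≠ 0 := pow_ne_zero _ hp0
  have hPq : P ^ 2 = q ^ (n + 1) := by rw [hP, ← hp]; ring
  have s1 : p ^ (1 - ((n + 2 : ℕ) : ℤ)) = p ^ (1 - (n : ℤ)) * q⁻¹ := by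
    rw [← hp, ← zpow_natCast p 2, ← zpow_neg, ← zpow_add₀ hp0]
    congr 1
    push_cast
    ring
  have s2 : p ^ (1 - (n : ℤ)) * q⁻¹ = P⁻¹ := by
    rw [← s1, hP, ← zpow_natCast p (n + 1), ← zpow_neg]
    congr 1
  have s3 : p ^ (1 - (n : ℤ)) * q ^ n = P := by
    rw [hP, ← hp, ← pow_mul, ← zpow_natCast p (2 * n), ← zpow_add₀ hp0, ← zpow_natCast p (n + 1)]
    congr 1
    push_cast
    ring
  have hA : ∀ w : ℂ, qPoch (-Complex.I * p ^ (1 - ((n + 2 : ℕ) : ℤ)) * w) q (n + 2) =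
      (1 + Complex.I * P⁻¹ * w) * (1 + Complex.I * P * w) *
        qPoch (-Complex.I * p ^ (1 - (n : ℤ)) * w) q n := fun w => by
    rw [s1, show -Complex.I * (p ^ (1 - (n : ℤ)) * q⁻¹) * w =
      -Complex.I * p ^ (1 - (n : ℤ)) * w * q⁻¹ by ring, qPoch_mul_inv_add_two hq0]
    linear_combination (-Complex.I * w * -1 * (1 + Complex.I * P * w) *
        qPoch (-Complex.I * p ^ (1 - (n : ℤ)) * w) q n) * s2 +
      (Complex.I * w * (1 + Complex.I * (p ^ (1 - (n : ℤ)) * q⁻¹) * w) *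
        qPoch (-Complex.I * p ^ (1 - (n : ℤ)) * w) q n) * s3
  have hprod : (1 + Complex.I * P⁻¹ * z) * (1 + Complex.I * P * z) *
      ((1 + Complex.I * P⁻¹ * z⁻¹) * (1 + Complex.I * P * z⁻¹)) * P ^ 2 =
      -(1 + P ^ 4 + P ^ 2 * (z ^ 2 + z⁻¹ ^ 2)) := by
    field_simp
    ring_nf
    simp only [Complex.I_sq, Complex.I_pow_three, Complex.I_pow_four]
    ring
  have h1 := qPoch_self_ne_zero hq n
  have h2 := one_sub_pow_succ_ne_zero hq n
  have h3 := one_sub_pow_succ_ne_zero hq (n + 1)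
  have hrn : r ^ ((n + 2) ^ 2) = r ^ (n ^ 2) * P ^ 2 := by rw [hP, hpdef]; ring
  have hI : (-Complex.I) ^ (n + 2) = -(-Complex.I) ^ n := by
    rw [pow_add, neg_sq, Complex.I_sq]
    ring
  simp only [qExpCoeff, ← hpdef, hA, hrn, hI, qPoch_self_succ]
  generalize qPoch (-Complex.I * p ^ (1 - (n : ℤ)) * z) q n = U
  generalize qPoch (-Complex.I * p ^ (1 - (n : ℤ)) * z⁻¹) q n = V
  have e1 : q + q ^ 2 * (z ^ 2 + z⁻¹ ^ 2) * q ^ n + q ^ 3 * q ^ (2 * n) =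
      q * (1 + P ^ 4 + P ^ 2 * (z ^ 2 + z⁻¹ ^ 2)) := by
    rw [show P ^ 4 = (P ^ 2) ^ 2 by ring, hPq]
    ring
  have e2 : q - q ^ (n + 2) = q * (1 - q ^ (n + 1)) := by ring
  rw [e1, e2, ← neg_neg (1 + P ^ 4 + P ^ 2 * (z ^ 2 + z⁻¹ ^ 2)), ← hprod]
  generalize (1 + Complex.I * P⁻¹ * z) * (1 + Complex.I * P * z) = M
  generalize (1 + Complex.I * P⁻¹ * z⁻¹) * (1 + Complex.I * P * z⁻¹) = N
  rw [show n + 2 = n + 1 + 1 from rfl]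
  field_simp

open PowerSeries in
/-- The coefficientwise form of
`(t²; q²)_∞ 𝓔_q(x; -i, -it) = ∑ q^{n²/4} H_n(x; 0 | q) tⁿ / (q; q)_n`: both sides satisfy the same
second-order recursion. -/
lemma qExpCoeff_eq_coeff {q r z : ℂ} (hq0 : q ≠ 0) (hq : ‖q‖ < 1) (hz : z ≠ 0)
    (hr : r ^ 4 = q) (n : ℕ) :
    qExpCoeff q r z n = coeff n (thetaHermiteSeries q r z * evenEulerSeries q) := by
  induction n using Nat.twoStepInduction with
  | zero =>
    simp [qExpCoeff, coeff_mul, thetaHermiteSeries, evenEulerSeries, bigQHermiteSeries,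
      qBinomialSeries, eulerSeries, qPoch_zero, -coeff_zero_eq_constantCoeff, coeff_rescale]
  | one =>
    have h := one_sub_pow_succ_ne_zero hq 0
    simp only [zero_add, pow_one] at h
    have hI := Complex.I_sq
    simp [qExpCoeff, coeff_mul, thetaHermiteSeries, evenEulerSeries, bigQHermiteSeries,
      qBinomialSeries, eulerSeries, qPoch, -coeff_zero_eq_constantCoeff, coeff_rescale,
      Finset.Nat.antidiagonal_succ]
    field_simp
    linear_combination -r * (1 + Complex.I * z + z ^ 2) * hI
  | more n ih _ =>
    have h := one_sub_pow_succ_ne_zero hq (n + 1)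
    have h' := one_sub_pow_succ_ne_zero hq n
    have h2 : q - q ^ (n + 2) ≠ 0 := by
      rw [show q - q ^ (n + 2) = q * (1 - q ^ (n + 1)) by ring]
      exact mul_ne_zero hq0 h'
    refine mul_left_cancel₀ (mul_ne_zero h2 h) ?_
    rw [qExpCoeff_succ_succ hq0 hq hz hr, coeff_theta_mul_evenEuler_succ_succ hq hz hr, ih]

/-! ### The generating function of the continuous big `q`-Hermite polynomials -/

/-- The reversal `(q^{-n}; q)_k (q; q)_{n-k} q^{nk} = (-1)^k q^{k(k-1)/2} (q; q)_n`, for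
`n = k + l`. -/
lemma qPoch_neg_pow_mul {q : ℂ} (hq0 : q ≠ 0) (k l : ℕ) :
    qPoch (q ^ (-((k + l : ℕ) : ℤ))) q k * qPoch q q l * q ^ ((k + l) * k) =
      (-1) ^ k * q ^ (k * (k - 1) / 2) * qPoch q q (k + l) := by
  induction k generalizing l with
  | zero => simp [qPoch_zero]
  | succ k ih =>
    have h := ih (l + 1)
    rw [show k + (l + 1) = k + 1 + l by ring] at h
    have e : (k + 1) * (k + 1 - 1) / 2 = k * (k - 1) / 2 + k := Nat.triangle_succ k
    have e' : q ^ (-((k + 1 + l : ℕ) : ℤ)) * q ^ k * q ^ (l + 1) = 1 := by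
      rw [zpow_neg, zpow_natCast, mul_assoc, ← pow_add, show k + (l + 1) = k + 1 + l by ring,
        inv_mul_cancel₀ (pow_ne_zero _ hq0)]
    rw [e, qPoch_succ (q ^ (-((k + 1 + l : ℕ) : ℤ)))]
    rw [qPoch_self_succ] at h
    generalize q ^ (-((k + 1 + l : ℕ) : ℤ)) = w at h e' ⊢
    generalize qPoch w q k = U at h ⊢
    linear_combination -(q ^ k) * h - (U * qPoch q q l * q ^ ((k + 1 + l) * k) * q ^ k) * e'

lemma qPoch_neg_pow_eq_zero {q : ℂ} (hq0 : q ≠ 0) {k n : ℕ} (h : n < k) :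
    qPoch (q ^ (-(n : ℤ))) q k = 0 := by
  refine Finset.prod_eq_zero (Finset.mem_range.mpr h) ?_
  rw [zpow_neg, zpow_natCast, inv_mul_cancel₀ (pow_ne_zero n hq0), sub_self]

open PowerSeries in
/-- The series `bigQHermiteSeries` is the generating function of the polynomials `H_n(x; a | q)`. -/
lemma coeff_bigQHermiteSeries {q : ℂ} (hq0 : q ≠ 0) (hq : ‖q‖ < 1) (θ a : ℂ) (n : ℕ) :
    coeff n (bigQHermiteSeries q a (Complex.exp (Complex.I * θ))) =
      bigQHermite q n θ a / qPoch q q n := by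
  have hz : Complex.exp (Complex.I * θ) ≠ 0 := Complex.exp_ne_zero _
  have e1 : Complex.exp (Complex.I * n * θ) = Complex.exp (Complex.I * θ) ^ n := by
    rw [← Complex.exp_nat_mul]
    ring_nf
  have e2 : Complex.exp (-2 * Complex.I * θ) = (Complex.exp (Complex.I * θ))⁻¹ ^ 2 := by
    rw [← Complex.exp_neg, ← Complex.exp_nat_mul]
    push_cast
    ring_nf
  rw [bigQHermite, e1, e2]
  generalize Complex.exp (Complex.I * θ) = z at hz ⊢
  rw [basicHypergeometric, tsum_eq_sum (s := Finset.range (n + 1)), bigQHermiteSeries, coeff_mul,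
    Finset.Nat.sum_antidiagonal_eq_sum_range_succ_mk, Finset.mul_sum, Finset.sum_div]
  · refine Finset.sum_congr rfl fun k hk => ?_
    obtain ⟨l, rfl⟩ := Nat.exists_eq_add_of_le (Nat.lt_succ_iff.mp (Finset.mem_range.mp hk))
    have h := qPoch_neg_pow_mul hq0 k l
    have h1 := qPoch_self_ne_zero hq k
    have h2 := qPoch_self_ne_zero hq l
    have h3 := qPoch_self_ne_zero hq (k + l)
    have h4 : ((-1 : ℂ) ^ k * q ^ (k * (k - 1) / 2)) ≠ 0 :=
      mul_ne_zero (pow_ne_zero _ (by norm_num)) (pow_ne_zero _ hq0)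
    have e3 : (1 : ℤ) + 0 - 2 = -1 := by norm_num
    simp only [List.map_cons, List.map_nil, List.prod_cons, List.prod_nil, mul_one,
      List.length_cons, List.length_nil, zero_add, Nat.cast_zero, coeff_rescale, qBinomialSeries,
      eulerSeries, coeff_mk, Nat.add_sub_cancel_left, Nat.reduceAdd, Nat.cast_ofNat, e3,
      zpow_neg_one]
    generalize qPoch (q ^ (-((k + l : ℕ) : ℤ))) q k = A at h ⊢
    generalize (-1 : ℂ) ^ k * q ^ (k * (k - 1) / 2) = B at h h4 ⊢
    have hA : A = B * qPoch q q (k + l) / (qPoch q q l * q ^ ((k + l) * k)) := by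
      field_simp
      linear_combination h
    have hzz : z ^ (k + l) * (z⁻¹ ^ 2) ^ k = z⁻¹ ^ k * z ^ l := by
      simp only [inv_pow]
      field_simp
      ring
    rw [mul_pow, ← pow_mul, hA]
    generalize qPoch (a * z) q k = V
    calc _ = (z⁻¹ ^ k * z ^ l) * (V / qPoch q q k / qPoch q q l) := by ring
      _ = _ := by
        rw [← hzz]
        field_simp
  · intro k hk
    have hk' : n < k := by simpa using hk
    have h := qPoch_neg_pow_eq_zero hq0 hk'
    simp only [List.map_cons, List.prod_cons, h, zero_mul, zero_div]

/-! ### Growth of the coefficients -/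

lemma summable_pow_sq_mul_pow {ρ M : ℝ} (h0 : 0 ≤ ρ) (h1 : ρ < 1) (hM : 0 ≤ M) :
    Summable fun n : ℕ => ρ ^ (n ^ 2) * M ^ n := by
  have hlim : Filter.Tendsto (fun n : ℕ => ρ ^ n * M) Filter.atTop (nhds 0) := by
    simpa using (tendsto_pow_atTop_nhds_zero_of_lt_one h0 h1).mul_const M
  refine Summable.of_norm_bounded_eventually_nat summable_geometric_two ?_
  filter_upwards [hlim.eventually_le_const (by norm_num : (0 : ℝ) < 1 / 2)] with n hn
  rw [sq, pow_mul, ← mul_pow, norm_pow, Real.norm_of_nonneg (by positivity)]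
  exact pow_le_pow_left₀ (by positivity) hn n

lemma norm_qPoch_le {q : ℂ} (hq : ‖q‖ < 1) (a : ℂ) (n : ℕ) : ‖qPoch a q n‖ ≤ (1 + ‖a‖) ^ n := by
  rw [qPoch, norm_prod]
  refine (Finset.prod_le_prod (g := fun _ => 1 + ‖a‖) (fun _ _ => norm_nonneg _)
    fun k _ => ?_).trans (by rw [Finset.prod_const, Finset.card_range])
  refine (norm_sub_le _ _).trans ?_
  rw [norm_one, norm_mul, norm_pow]
  gcongr
  exact mul_le_of_le_one_right (norm_nonneg a) (pow_le_one₀ (norm_nonneg q) hq.le)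

lemma norm_inv_qPoch_self_le {q : ℂ} (hq : ‖q‖ < 1) (n : ℕ) :
    ‖(qPoch q q n)⁻¹‖ ≤ (1 - ‖q‖)⁻¹ ^ n := by
  have hpos : 0 < 1 - ‖q‖ := sub_pos.mpr hq
  rw [norm_inv, inv_pow]
  refine inv_anti₀ (pow_pos hpos n) ?_
  rw [qPoch, norm_prod]
  refine le_trans (by rw [Finset.prod_const, Finset.card_range])
    (Finset.prod_le_prod (s := Finset.range n) (f := fun _ => 1 - ‖q‖) (fun _ _ => hpos.le)
      fun k _ => ?_)
  have h1 : ‖q * q ^ k‖ ≤ ‖q‖ := by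
    rw [norm_mul, norm_pow]
    exact mul_le_of_le_one_right (norm_nonneg q) (pow_le_one₀ (norm_nonneg q) hq.le)
  have h2 := norm_sub_norm_le (1 : ℂ) (q * q ^ k)
  rw [norm_one] at h2
  linarith

section Bounds

open PowerSeries

/-- A formal power series whose coefficients grow at most geometrically. -/
def GeomBounded (f : PowerSeries ℂ) : Prop :=
  ∃ M : ℝ, 0 ≤ M ∧ ∀ n, ‖coeff n f‖ ≤ M ^ n

lemma GeomBounded.mul {f g : PowerSeries ℂ} (hf : GeomBounded f) (hg : GeomBounded g) :
    GeomBounded (f * g) := by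
  obtain ⟨M, hM, hf⟩ := hf
  obtain ⟨N, hN, hg⟩ := hg
  refine ⟨2 * max M N, by positivity, fun n => ?_⟩
  rw [coeff_mul, mul_pow]
  have h : ∀ x ∈ Finset.HasAntidiagonal.antidiagonal n, ‖coeff x.1 f * coeff x.2 g‖ ≤ max M N ^ n := by
    intro x hx
    rw [← Finset.HasAntidiagonal.mem_antidiagonal.mp hx, pow_add, norm_mul]
    exact mul_le_mul ((hf _).trans (pow_le_pow_left₀ hM (le_max_left _ _) _))
      ((hg _).trans (pow_le_pow_left₀ hN (le_max_right _ _) _)) (norm_nonneg _) (by positivity)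
  refine (norm_sum_le_of_le _ h).trans ?_
  rw [Finset.sum_const, Finset.Nat.card_antidiagonal, nsmul_eq_mul]
  gcongr
  exact_mod_cast Nat.lt_two_pow_self

lemma GeomBounded.rescale {f : PowerSeries ℂ} (hf : GeomBounded f) (a : ℂ) :
    GeomBounded (PowerSeries.rescale a f) := by
  obtain ⟨M, hM, hf⟩ := hf
  refine ⟨‖a‖ * M, by positivity, fun n => ?_⟩
  rw [coeff_rescale, norm_mul, norm_pow, mul_pow]
  gcongr
  exact hf n

lemma geomBounded_qBinomialSeries {q : ℂ} (hq : ‖q‖ < 1) (u : ℂ) :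
    GeomBounded (qBinomialSeries q u) := by
  have hpos : 0 < 1 - ‖q‖ := sub_pos.mpr hq
  refine ⟨(1 + ‖u‖) * (1 - ‖q‖)⁻¹, by positivity, fun n => ?_⟩
  rw [qBinomialSeries, coeff_mk, div_eq_mul_inv, norm_mul, mul_pow]
  exact mul_le_mul (norm_qPoch_le hq u n) (norm_inv_qPoch_self_le hq n) (norm_nonneg _)
    (by positivity)

lemma geomBounded_eulerSeries {q : ℂ} (hq : ‖q‖ < 1) (u : ℂ) : GeomBounded (eulerSeries q u) := by
  have hpos : 0 < 1 - ‖q‖ := sub_pos.mpr hq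
  refine ⟨‖u‖ * (1 - ‖q‖)⁻¹, by positivity, fun n => ?_⟩
  rw [eulerSeries, coeff_mk, div_eq_mul_inv, norm_mul, mul_pow, norm_pow]
  gcongr
  exact norm_inv_qPoch_self_le hq n

lemma geomBounded_bigQHermiteSeries {q : ℂ} (hq : ‖q‖ < 1) (a z : ℂ) :
    GeomBounded (bigQHermiteSeries q a z) :=
  ((geomBounded_qBinomialSeries hq _).rescale _).mul (geomBounded_eulerSeries hq z)

/-- Geometrically bounded coefficients become summable at every point once they are multiplied
by `r^{n²}`. -/
lemma GeomBounded.summable_norm_pow_sq_mul {f : PowerSeries ℂ} (hf : GeomBounded f) {r : ℂ}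
    (hr : ‖r‖ < 1) (t : ℂ) : Summable fun n : ℕ => ‖r ^ (n ^ 2) * coeff n f * t ^ n‖ := by
  obtain ⟨M, hM, hf⟩ := hf
  refine Summable.of_nonneg_of_le (fun _ => norm_nonneg _) (fun n => ?_)
    (summable_pow_sq_mul_pow (norm_nonneg r) hr (mul_nonneg hM (norm_nonneg t)))
  rw [norm_mul, norm_mul, norm_pow, norm_pow, mul_pow, ← mul_assoc]
  gcongr
  exact hf n

end Bounds

/-! ### Euler's identity and evaluation of the series -/

lemma summable_norm_pow_div_qPoch {q x : ℂ} (hq : ‖q‖ < 1) (hx : ‖x‖ < 1) :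
    Summable fun k : ℕ => ‖x ^ k / qPoch q q k‖ := by
  obtain ⟨ρ, hρ, hρ1⟩ := exists_between hx
  refine summable_of_ratio_norm_eventually_le (r := ρ) hρ1 ?_
  have hlim : Filter.Tendsto (fun n : ℕ => ‖x / (1 - q ^ (n + 1))‖) Filter.atTop (nhds ‖x‖) := by
    have h := ((tendsto_pow_atTop_nhds_zero_of_norm_lt_one hq).comp
      (Filter.tendsto_add_atTop_nat 1)).const_sub 1
    simpa using ((tendsto_const_nhds (x := x)).div h (by simp)).norm
  filter_upwards [hlim.eventually_le_const hρ] with n hn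
  rw [norm_norm, norm_norm, qPoch_self_succ, pow_succ, mul_div_mul_comm, norm_mul, mul_comm]
  gcongr

/-- Euler's identity `(x; q)_∞ ∑ xᵏ / (q; q)_k = 1`. -/
lemma qPochInf_mul_tsum {q x : ℂ} (hq : ‖q‖ < 1) (hx : ‖x‖ < 1) :
    qPochInf x q * ∑' k : ℕ, x ^ k / qPoch q q k = 1 := by
  set S : ℂ → ℂ := fun y => ∑' k : ℕ, y ^ k / qPoch q q k with hS
  have hnorm : ∀ n : ℕ, ‖x * q ^ n‖ ≤ ‖x‖ := fun n => by
    rw [norm_mul, norm_pow]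
    exact mul_le_of_le_one_right (norm_nonneg x) (pow_le_one₀ (norm_nonneg q) hq.le)
  have hstep : ∀ y : ℂ, ‖y‖ < 1 → S (y * q) = (1 - y) * S y := by
    intro y hy
    have hyq : ‖y * q‖ < 1 := by
      rw [norm_mul]
      exact (mul_le_of_le_one_right (norm_nonneg y) hq.le).trans_lt hy
    have s1 := (summable_norm_pow_div_qPoch hq hy).of_norm
    have s2 := (summable_norm_pow_div_qPoch hq hyq).of_norm
    have e1 := s1.tsum_eq_zero_add
    have e2 := s2.tsum_eq_zero_add
    have s1' := (summable_nat_add_iff 1).mpr s1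
    have h : ∑' k : ℕ, (y * q) ^ (k + 1) / qPoch q q (k + 1) =
        ∑' k : ℕ, y ^ (k + 1) / qPoch q q (k + 1) - y * ∑' k : ℕ, y ^ k / qPoch q q k := by
      rw [← tsum_mul_left, ← s1'.tsum_sub (s1.mul_left y)]
      refine tsum_congr fun k => ?_
      have h1 := qPoch_self_ne_zero hq k
      have h2 := one_sub_pow_succ_ne_zero hq k
      rw [qPoch_self_succ]
      field_simp
      ring
    simp only [pow_zero, qPoch_zero, div_one] at e1 e2
    simp only [hS]
    rw [e2, h]
    linear_combination -e1
  -- The relation `S(qy) = (1 - y) S(y)` is iterated and `q^n → 0` is used.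
  have hiter : ∀ n : ℕ, S (x * q ^ n) = qPoch x q n * S x := by
    intro n
    induction n with
    | zero => simp [qPoch_zero]
    | succ n ih =>
      rw [pow_succ, ← mul_assoc, hstep _ ((hnorm n).trans_lt hx), ih, qPoch_succ]
      ring
  have hlim1 : Filter.Tendsto (fun n => qPoch x q n * S x) Filter.atTop
      (nhds (qPochInf x q * S x)) :=
    (multipliable_qPochInf x q hq).hasProd.tendsto_prod_nat.mul_const _
  have hlim2 : Filter.Tendsto (fun n => S (x * q ^ n)) Filter.atTop (nhds (S 0)) := by
    refine tendsto_tsum_of_dominated_convergence (summable_norm_pow_div_qPoch hq hx) ?_ ?_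
    · intro k
      have h := (tendsto_pow_atTop_nhds_zero_of_norm_lt_one hq).const_mul x
      rw [mul_zero] at h
      exact (h.pow k).div_const _
    · refine Filter.Eventually.of_forall fun n k => ?_
      rw [norm_div, norm_div, norm_pow, norm_pow]
      gcongr
      exact hnorm n
  have hS0 : S 0 = 1 := by
    simp only [hS]
    rw [tsum_eq_single 0 fun k hk => by simp [hk]]
    simp [qPoch_zero]
  simp only [hiter] at hlim2
  rw [← hS0]
  exact tendsto_nhds_unique hlim1 hlim2

open PowerSeries in
/-- The series `evenEulerSeries` converges absolutely for `|t| < 1`, and its value is Euler's series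
for `1 / (t²; q²)_∞`. -/
lemma evenEulerSeries_eval {q t : ℂ} (hq : ‖q‖ < 1) (ht : ‖t‖ < 1) :
    (Summable fun n : ℕ => ‖coeff n (evenEulerSeries q) * t ^ n‖) ∧
      ∑' n : ℕ, coeff n (evenEulerSeries q) * t ^ n =
        ∑' s : ℕ, (t ^ 2) ^ s / qPoch (q ^ 2) (q ^ 2) s := by
  have hinj : Function.Injective fun s : ℕ => 2 * s := fun a b h => by
    simpa using h
  have hzero : ∀ n ∉ Set.range (fun s : ℕ => 2 * s), coeff n (evenEulerSeries q) * t ^ n = 0 := by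
    intro n hn
    have h : ¬ Even n := fun ⟨s, hs⟩ => hn ⟨s, by simp only; omega⟩
    simp [evenEulerSeries, h]
  have hcomp : ∀ s : ℕ, coeff (2 * s) (evenEulerSeries q) * t ^ (2 * s) =
      (t ^ 2) ^ s / qPoch (q ^ 2) (q ^ 2) s := fun s => by
    simp [evenEulerSeries, pow_mul, div_eq_inv_mul]
  have hs := summable_norm_pow_div_qPoch (norm_sq_lt_one hq) (norm_sq_lt_one ht)
  constructor
  · refine (hinj.summable_iff fun n hn => by rw [hzero n hn, norm_zero]).mp ?_
    simpa only [Function.comp_def, hcomp] using hs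
  · refine HasSum.tsum_eq ((hinj.hasSum_iff hzero).mp ?_)
    simpa only [Function.comp_def, hcomp] using hs.of_norm.hasSum

open PowerSeries in
/-- The expansion `(t²; q²)_∞ 𝓔_q(x; -i, -it) = ∑ q^{n²/4} H_n(x; 0 | q) tⁿ / (q; q)_n` for
`|t| < 1`. -/
lemma qExpCoeff_eval {q r z t : ℂ} (hq0 : q ≠ 0) (hq : ‖q‖ < 1) (hz : z ≠ 0) (hr : r ^ 4 = q)
    (hr1 : ‖r‖ < 1) (ht : ‖t‖ < 1) :
    (Summable fun n : ℕ => qExpCoeff q r z n * t ^ n) ∧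
      ∑' n : ℕ, qExpCoeff q r z n * t ^ n =
        (qPochInf (t ^ 2) (q ^ 2))⁻¹ *
          ∑' n : ℕ, r ^ (n ^ 2) * coeff n (bigQHermiteSeries q 0 z) * t ^ n := by
  have hF := (geomBounded_bigQHermiteSeries hq 0 z).summable_norm_pow_sq_mul hr1 t
  obtain ⟨hQ, hQe⟩ := evenEulerSeries_eval hq ht
  have hterm : ∀ n : ℕ, qExpCoeff q r z n * t ^ n = ∑ x ∈ Finset.HasAntidiagonal.antidiagonal n,
      r ^ (x.1 ^ 2) * coeff x.1 (bigQHermiteSeries q 0 z) * t ^ x.1 *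
        (coeff x.2 (evenEulerSeries q) * t ^ x.2) := fun n => by
    rw [qExpCoeff_eq_coeff hq0 hq hz hr, coeff_mul, Finset.sum_mul]
    refine Finset.sum_congr rfl fun x hx => ?_
    rw [← Finset.HasAntidiagonal.mem_antidiagonal.mp hx, thetaHermiteSeries, coeff_mk, pow_add]
    ring
  simp only [hterm]
  refine ⟨(summable_norm_sum_mul_antidiagonal_of_summable_norm hF hQ).of_norm, ?_⟩
  rw [← tsum_mul_tsum_eq_tsum_sum_antidiagonal_of_summable_norm hF hQ, hQe, mul_comm,
    eq_inv_of_mul_eq_one_right (qPochInf_mul_tsum (norm_sq_lt_one hq) (norm_sq_lt_one ht))]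

open PowerSeries in
/-- Inserting the connection relation into `∑ q^{n²/4} H_n(x; 0 | q) tⁿ / (q; q)_n` and summing
the resulting double series in the other order. -/
lemma thetaHermite_eval {q r z : ℂ} (hq : ‖q‖ < 1) (hz : z ≠ 0) (hr1 : ‖r‖ < 1) (t a : ℂ) :
    (Summable fun k : ℕ => ∑' j : ℕ, r ^ ((k + j) ^ 2) * t ^ (k + j) *
      (coeff k (bigQHermiteSeries q a z) * coeff j (eulerSeries q a))) ∧
    ∑' n : ℕ, r ^ (n ^ 2) * coeff n (bigQHermiteSeries q 0 z) * t ^ n =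
      ∑' k : ℕ, ∑' j : ℕ, r ^ ((k + j) ^ 2) * t ^ (k + j) *
        (coeff k (bigQHermiteSeries q a z) * coeff j (eulerSeries q a)) := by
  set u : ℕ × ℕ → ℂ := fun x => r ^ ((x.1 + x.2) ^ 2) * t ^ (x.1 + x.2) *
    (coeff x.1 (bigQHermiteSeries q a z) * coeff x.2 (eulerSeries q a)) with hu
  have hH := (geomBounded_bigQHermiteSeries hq a z).summable_norm_pow_sq_mul hr1 t
  have hE := (geomBounded_eulerSeries hq a).summable_norm_pow_sq_mul hr1 t
  have hsum : Summable u := by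
    refine Summable.of_norm_bounded (hH.mul_of_nonneg hE (fun _ => norm_nonneg _)
      fun _ => norm_nonneg _) fun x => ?_
    -- Since `(k + j)² = k² + j² + 2kj`, the terms are dominated by a product of two series.
    have h : u x = r ^ (2 * x.1 * x.2) *
        (r ^ (x.1 ^ 2) * coeff x.1 (bigQHermiteSeries q a z) * t ^ x.1 *
          (r ^ (x.2 ^ 2) * coeff x.2 (eulerSeries q a) * t ^ x.2)) := by
      simp only [hu]
      ring
    rw [h, norm_mul, norm_mul (_ * _ * _), norm_pow]
    exact mul_le_of_le_one_left (by positivity) (pow_le_one₀ (norm_nonneg r) hr1.le)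
  refine ⟨hsum.prod, ?_⟩
  have hsig : Summable fun c : Σ n : ℕ, Finset.HasAntidiagonal.antidiagonal n =>
      u (Finset.HasAntidiagonal.sigmaAntidiagonalEquivProd c) :=
    (Finset.HasAntidiagonal.sigmaAntidiagonalEquivProd.summable_iff).mpr hsum
  rw [← hsum.tsum_prod, ← Finset.HasAntidiagonal.sigmaAntidiagonalEquivProd.tsum_eq u,
    hsig.tsum_sigma]
  refine tsum_congr fun n => ?_
  rw [tsum_fintype, Finset.univ_eq_attach, ← eulerSeries_mul_bigQHermiteSeries hq hz a,
    mul_comm (eulerSeries q a), coeff_mul, Finset.mul_sum, Finset.sum_mul,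
    ← Finset.sum_attach]
  refine Finset.sum_congr rfl fun x _ => ?_
  have hx := Finset.HasAntidiagonal.mem_antidiagonal.mp x.2
  simp only [hu, Finset.HasAntidiagonal.sigmaAntidiagonalEquivProd_apply, hx]
  ring

/-! ### The expansion of the `q`-exponential -/

/-- Here `x = cos θ`. The value `𝓔_q(-; 0, ·)` does not depend on its first argument, which is
written as an arbitrary `φ`. -/
theorem mainTheorem1 (q b θ φ : ℂ) (m : ℤ) (hq0 : q ≠ 0) (hq1 : ‖q‖ < 1) (hb : ‖b‖ < 2) :
    Summable (qExpTerm q θ (-Complex.I) (b / 2)) ∧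
    (∀ n : ℕ, Summable
      (qExpTerm q φ 0 (Complex.I * b / 2 * q ^ (((m : ℂ) + (n : ℂ)) / 2)))) ∧
    qPochInf (-b ^ 2 / 4) (q ^ 2) ≠ 0 ∧
    Summable (fun n : ℕ =>
      q ^ ((n : ℂ) ^ 2 / 4) / qPoch q q n *
        qExp q φ 0 (Complex.I * b / 2 * q ^ (((m : ℂ) + (n : ℂ)) / 2)) *
        (Complex.I * b / 2) ^ n * bigQHermite q n θ (q ^ ((m : ℂ) / 2))) ∧
    qExp q θ (-Complex.I) (b / 2) =
      (qPochInf (-b ^ 2 / 4) (q ^ 2))⁻¹ *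
        ∑' n : ℕ,
          q ^ ((n : ℂ) ^ 2 / 4) / qPoch q q n *
            qExp q φ 0 (Complex.I * b / 2 * q ^ (((m : ℂ) + (n : ℂ)) / 2)) *
            (Complex.I * b / 2) ^ n * bigQHermite q n θ (q ^ ((m : ℂ) / 2)) := by
  -- With `t = ib/2`, `z = e^{iθ}` and `r = q^{1/4}`, every power of `q` below is an integral power
  -- of `r`, up to the factor `a = q^{m/2}`.
  set r : ℂ := q ^ ((1 : ℂ) / 4) with hrdef
  set t : ℂ := Complex.I * b / 2 with htdef
  set z : ℂ := Complex.exp (Complex.I * θ) with hzdef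
  set a : ℂ := q ^ ((m : ℂ) / 2) with hadef
  have hz : z ≠ 0 := Complex.exp_ne_zero _
  have hr : r ^ 4 = q := by
    rw [hrdef, ← Complex.cpow_nat_mul]
    norm_num
  have hr1 : ‖r‖ < 1 := by
    by_contra! h
    have h4 : ‖r‖ ^ 4 = ‖q‖ := by rw [← norm_pow, hr]
    exact absurd (one_le_pow₀ h) (by rw [h4]; exact not_le.mpr hq1)
  have ht : ‖t‖ < 1 := by
    rw [htdef, norm_div, norm_mul, Complex.norm_I, one_mul, Complex.norm_two]
    linarith
  have hb2 : b / 2 = -Complex.I * t := by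
    rw [htdef]
    linear_combination (b / 2) * Complex.I_sq
  have ht2 : -b ^ 2 / 4 = t ^ 2 := by
    rw [htdef]
    linear_combination (-b ^ 2 / 4) * Complex.I_sq
  have hpow : ∀ n : ℕ, q ^ ((n : ℂ) ^ 2 / 4) = r ^ (n ^ 2) := fun n => by
    rw [hrdef, ← Complex.cpow_nat_mul]
    congr 1
    push_cast
    ring
  have hr2 : r ^ 2 = q ^ ((1 : ℂ) / 2) := by
    rw [hrdef, ← Complex.cpow_nat_mul]
    congr 1
    push_cast
    ring
  have hhalf : ∀ n : ℕ, q ^ ((1 - (n : ℂ)) / 2) = (r ^ 2) ^ (1 - (n : ℤ)) := fun n => by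
    rw [hr2, ← Complex.cpow_int_mul]
    congr 1
    push_cast
    ring
  have hshift : ∀ n : ℕ, q ^ (((m : ℂ) + (n : ℂ)) / 2) = a * (r ^ 2) ^ n := fun n => by
    rw [hr2, ← Complex.cpow_nat_mul, hadef, ← Complex.cpow_add _ _ hq0]
    congr 1
    ring
  have hzinv : Complex.exp (-Complex.I * θ) = z⁻¹ := by
    rw [hzdef, ← Complex.exp_neg, neg_mul]
  have hterm : ∀ n, qExpTerm q θ (-Complex.I) (b / 2) n = qExpCoeff q r z n * t ^ n := fun n => by
    rw [qExpTerm, qExpCoeff, hpow, hhalf, hzinv, hb2, mul_pow]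
    ring
  have hterm0 : ∀ B n, qExpTerm q φ 0 B n =
      r ^ (n ^ 2) * PowerSeries.coeff n (eulerSeries q 1) * B ^ n := fun B n => by
    simp only [qExpTerm, hpow, zero_mul, qPoch_zero_left, eulerSeries, PowerSeries.coeff_mk]
    ring
  have hrhs : ∀ n : ℕ, q ^ ((n : ℂ) ^ 2 / 4) / qPoch q q n *
      qExp q φ 0 (t * q ^ (((m : ℂ) + (n : ℂ)) / 2)) * t ^ n * bigQHermite q n θ a =
      ∑' j : ℕ, r ^ ((n + j) ^ 2) * t ^ (n + j) *
        (PowerSeries.coeff n (bigQHermiteSeries q a z) *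
          PowerSeries.coeff j (eulerSeries q a)) := fun n => by
    rw [coeff_bigQHermiteSeries hq0 hq1, qExp, hpow, hshift]
    calc _ = r ^ (n ^ 2) * t ^ n * (bigQHermite q n θ a / qPoch q q n) *
          ∑' j : ℕ, qExpTerm q φ 0 (t * (a * (r ^ 2) ^ n)) j := by ring
      _ = _ := by
        rw [← tsum_mul_left]
        refine tsum_congr fun j => ?_
        rw [hterm0]
        simp only [eulerSeries, PowerSeries.coeff_mk]
        ring
  obtain ⟨hs1, he1⟩ := qExpCoeff_eval hq0 hq1 hz hr hr1 ht
  obtain ⟨hs2, he2⟩ := thetaHermite_eval hq1 hz hr1 t a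
  refine ⟨by simpa only [funext hterm] using hs1, fun n => ?_, ?_, ?_, ?_⟩
  · rw [funext (hterm0 _)]
    exact ((geomBounded_eulerSeries hq1 1).summable_norm_pow_sq_mul hr1 _).of_norm
  · rw [ht2]
    exact left_ne_zero_of_mul_eq_one
      (qPochInf_mul_tsum (norm_sq_lt_one hq1) (norm_sq_lt_one ht))
  · simpa only [hrhs] using hs2
  · rw [qExp, tsum_congr hterm, he1, he2, ht2, tsum_congr hrhs]
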